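/- (Khovanov's conjecture.) Let $n\ge 0$, let $E$ be a complex vector space of dimension $2n$, and let $z\colon E\to E$ be a nilpotent linear endomorphism with two Jordan blocks, each of size $n$. Let $$\mathfrak{B}_{n,n}:=\{\,0=L_0\subsetneq L_1\subsetneq\dots\subsetneq L_{2n}=E \;:\; zL_j\subset L_j \text{ for all } j\,\}$$ be the $(n,n)$ Springer variety of complete flags of linear subspaces of $E$ stabilized by $z$, with its classical topology, that is, the subspace topology from the variety of complete flags in $E$. A crossingless matching of $2n$ points is a partition $a$ of $\{1,\dots,2n\}$ into pairs such that there are no $i<j<k<l$ with $\{i,k\}\in a$ and $\{j,l\}\in a$. Let $O_a$ be the set of the smaller elements of the pairs of $a$, and for $j\in O_a$ let $s_a(j)>j$ be the element paired with $j$. Put $$S_a:=\{(l_1,\dots,l_{2n})\in(\mathbb{P}^1)^{2n} : l_j=l_{s_a(j)} \text{ for all } j\in O_a\},\qquad \widetilde S:=\bigcup_a S_a\subset(\mathbb{P}^1)^{2n},$$ where $\mathbb{P}^1$ is the complex projective line with its classical topology and the union is over all crossingless matchings $a$ of $2n$ points. Then $\mathfrak{B}_{n,n}$ and $\widetilde S$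 are homeomorphic. -/

import Mathlib

/-- The classical topology on a projective space: the quotient topology from `V ∖ {0}`. -/
instance Projectivization.instTopologicalSpaceQuotient
    (K V : Type*) [DivisionRing K] [AddCommGroup V] [Module K V] [TopologicalSpace V] :
    TopologicalSpace (Projectivization K V) :=
  inferInstanceAs (TopologicalSpace (Quotient (projectivizationSetoid K V)))

/-- The complex projective line, the space of lines in `ℂ²`. -/
abbrev ComplexProjectiveLine : Type :=
  Projectivization ℂ (Fin 2 → ℂ)

/-- The linear endomorphism `z` is nilpotent with exactly two Jordan blocks, each of size `n`:
there is a basis `b (i, k)`, with `i` the number of the block and `k` the position in it, such that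
`z` sends the first vector of each block to `0` and every other one to its predecessor. -/
def HasTwoNilpotentJordanBlocks {E : Type*} [AddCommGroup E] [Module ℂ E]
    (n : ℕ) (z : E →ₗ[ℂ] E) : Prop :=
  ∃ b : Module.Basis (Fin 2 × Fin n) ℂ E,
    ∀ (i : Fin 2) (k : Fin n),
      ((k : ℕ) = 0 → z (b (i, k)) = 0) ∧
      ∀ k' : Fin n, (k : ℕ) = (k' : ℕ) + 1 → z (b (i, k)) = b (i, k')

/-- A complete flag `0 = L₀ ⊊ L₁ ⊊ ⋯ ⊊ L_m = E` in a complex vector space `E`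
(to be used with `m` the dimension of `E`). -/
@[ext]
structure CompleteFlag (m : ℕ) (E : Type*) [AddCommGroup E] [Module ℂ E] where
  /-- The subspaces of the flag. -/
  space : Fin (m + 1) → Submodule ℂ E
  strictMono : StrictMono space
  space_zero : space 0 = ⊥
  space_last : space (Fin.last m) = ⊤

namespace CompleteFlag

variable {m : ℕ} {E : Type*} [AddCommGroup E] [Module ℂ E]

/-- The complete flag of an ordered basis `b₁, …, b_m`: its `j`-th space is the span of
`b₁, …, b_j`. -/
def ofBasis (b : Module.Basis (Fin m) ℂ E) : CompleteFlag m E where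
  space := b.flag
  strictMono := b.flag_strictMono
  space_zero := b.flag_zero
  space_last := b.flag_last

/-- The classical topology of the flag variety: the quotient topology from the space of ordered
bases of `E`, which is topologized as a subspace of `E ^ m`. -/
noncomputable instance instTopologicalSpaceOfBases [TopologicalSpace E] : TopologicalSpace (CompleteFlag m E) :=
  TopologicalSpace.coinduced ofBasis
    (TopologicalSpace.induced (fun (b : Module.Basis (Fin m) ℂ E) (i : Fin m) => b i)
      inferInstance)

end CompleteFlag

/-- The `(n, n)` Springer variety of `z`: the complete flags all of whose spaces are stable
under `z`. -/
def springerVariety {E : Type*} [AddCommGroup E] [Module ℂ E] (n : ℕ) (z : E →ₗ[ℂ] E) :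
    Set (CompleteFlag (2 * n) E) :=
  {L | ∀ j, (L.space j).map z ≤ L.space j}

/-- A crossingless matching of `2n` points: a partition of the points into pairs, given by the map
that sends each point to the other point of its pair, such that there are no `i < j < k < l`
with `i` paired with `k` and `j` paired with `l`. -/
@[ext]
structure CrossinglessMatching (n : ℕ) where
  /-- The point with which a given point is paired. -/
  partner : Fin (2 * n) → Fin (2 * n)
  partner_partner : ∀ i, partner (partner i) = i
  partner_ne : ∀ i, partner i ≠ i
  crossingless : ∀ i j k l, i < j → j < k → k < l → ¬ (partner i = k ∧ partner j = l)

namespace CrossinglessMatching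

variable {n : ℕ}

/-- The set `O_a` of left endpoints of the cups of `a`; the cup that starts at `j ∈ O_a` ends
at `s_a(j) = a.partner j`. -/
def leftEndpoints (a : CrossinglessMatching n) : Set (Fin (2 * n)) :=
  {i | i < a.partner i}

/-- The subspace `S_a` of `(ℙ¹)^{2n}`. -/
def subspace (a : CrossinglessMatching n) : Set (Fin (2 * n) → ComplexProjectiveLine) :=
  {l | ∀ j ∈ a.leftEndpoints, l j = l (a.partner j)}

end CrossinglessMatching

/-- The subspace `S̃` of `(ℙ¹)^{2n}`: the union of the `S_a` over all crossingless matchings. -/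
def khovanovSpace (n : ℕ) : Set (Fin (2 * n) → ComplexProjectiveLine) :=
  ⋃ a : CrossinglessMatching n, a.subspace

/-!
Encode `E` as `ℂ⟦t⟧² / tⁿ` with `z` acting as `t`. The `z`-stable flags become the chains of
`t`-stable subspaces of `ℂ⟦t⟧²` that descend by steps of codimension one from the whole space to
`tⁿ ℂ⟦t⟧²`. Each step is multiplication by an elementary factor `(1 - P) + t P`, where `P` is the
orthogonal projection onto a line, so a flag is a sequence of `2n` lines whose factors have a
product with image `tⁿ ℂ⟦t⟧²`. If `n > 0`, this product vanishes at `t = 0`, that is, the product of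
the projections `1 - P` is zero, and as these have rank one, two adjacent lines are orthogonal. The
product of their factors is `t`, which is central, so the two lines can be removed, and induction
applies. After every second line is replaced by its orthogonal complement, orthogonal neighbours
become equal neighbours, and removing equal neighbours until none is left traces out a crossingless
matching. The resulting bijection is continuous from a compact space to a Hausdorff one.
-/

open Matrix Module
open scoped ComplexOrder LinearAlgebra.Projectivization

section ProjectiveTopology

variable {K V W : Type*} [DivisionRing K] [AddCommGroup V] [Module K V] [TopologicalSpace V]
  [AddCommGroup W] [Module K W] [TopologicalSpace W]

theorem isOpenQuotientMap_projectivization_mk' [ContinuousConstSMul K V] :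
    IsOpenQuotientMap (Projectivization.mk' K : {v : V // v ≠ 0} → ℙ K V) where
  surjective := Quotient.mk_surjective
  continuous := continuous_quotient_mk'
  isOpenMap U hU := by
    let scale (c : Kˣ) (v : {v : V // v ≠ 0}) : {v : V // v ≠ 0} :=
      ⟨c • (v : V), (smul_ne_zero_iff_ne c).2 v.2⟩
    have saturation : Projectivization.mk' K ⁻¹' (Projectivization.mk' K '' U) =
        ⋃ c : Kˣ, scale c ⁻¹' U := by
      ext v
      simp only [Set.mem_preimage, Set.mem_image, Set.mem_iUnion, Projectivization.mk'_eq_mk,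
        Projectivization.mk_eq_mk_iff]
      constructor
      · rintro ⟨w, hw, c, hc⟩
        exact ⟨c, by rwa [show scale c v = w from Subtype.ext hc]⟩
      · rintro ⟨c, hc⟩
        exact ⟨_, hc, c, rfl⟩
    refine isOpen_coinduced.2 (saturation ▸ isOpen_iUnion fun c => hU.preimage ?_)
    exact (continuous_subtype_val.const_smul c).subtype_mk _

theorem continuous_projectivization_map {σ : K →+* K} [ContinuousConstSMul K V]
    {f : V →ₛₗ[σ] W} (hf : Function.Injective f) (hfc : Continuous f) :
    Continuous (Projectivization.map f hf) := by
  refine isOpenQuotientMap_projectivization_mk'.isQuotientMap.continuous_iff.2 ?_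
  exact continuous_quotient_mk'.comp ((hfc.comp continuous_subtype_val).subtype_mk _)

instance {𝕜 F : Type*} [RCLike 𝕜] [NormedAddCommGroup F] [NormedSpace 𝕜 F] [ProperSpace F] :
    CompactSpace (ℙ 𝕜 F) := by
  let f (v : Metric.sphere (0 : F) 1) : ℙ 𝕜 F :=
    Projectivization.mk' 𝕜 ⟨v, ne_zero_of_mem_unit_sphere v⟩
  have hf : Continuous f := continuous_quotient_mk'.comp (continuous_subtype_val.subtype_mk _)
  refine Function.Surjective.compactSpace (f := f) hf fun l => ?_
  induction l with
  | h u hu =>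
    refine ⟨⟨((‖u‖⁻¹ : ℝ) : 𝕜) • u, by simp [norm_smul, hu]⟩, ?_⟩
    exact (Projectivization.mk_eq_mk_iff' _ _ _ _ _).2 ⟨_, rfl⟩

end ProjectiveTopology

section LineProj

variable {𝕜 ι : Type*} [RCLike 𝕜] [Fintype ι]

/-- The matrix of the orthogonal projection of `𝕜 ^ ι` onto a line, for the standard Hermitian
form `star u ⬝ᵥ v`; working with matrices avoids the sup norm that `ι → 𝕜` carries. -/
noncomputable def lineProj : ℙ 𝕜 (ι → 𝕜) → Matrix ι ι 𝕜 :=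
  Projectivization.lift (fun u => (star u.1 ⬝ᵥ u.1)⁻¹ • vecMulVec u.1 (star u.1)) <| by
    rintro ⟨u, hu⟩ ⟨v, hv⟩ c rfl
    have hc : c ≠ 0 := fun h => hu (by simp [h])
    have hvv : star v ⬝ᵥ v ≠ 0 := dotProduct_star_self_eq_zero.not.2 hv
    simp only [star_smul, smul_dotProduct, dotProduct_smul, smul_vecMulVec, vecMulVec_smul,
      smul_smul, smul_eq_mul]
    congr 1
    have hc' : star c ≠ 0 := star_ne_zero.2 hc
    field_simp

theorem lineProj_mk (u : ι → 𝕜) (hu : u ≠ 0) :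
    lineProj (.mk 𝕜 u hu) = (star u ⬝ᵥ u)⁻¹ • vecMulVec u (star u) := rfl

theorem lineProj_mk_mulVec (u : ι → 𝕜) (hu : u ≠ 0) (v : ι → 𝕜) :
    lineProj (.mk 𝕜 u hu) *ᵥ v = ((star u ⬝ᵥ u)⁻¹ * (star u ⬝ᵥ v)) • u := by
  rw [lineProj_mk, smul_mulVec, vecMulVec_mulVec, op_smul_eq_smul, smul_smul]

theorem lineProj_mk_mulVec_self (u : ι → 𝕜) (hu : u ≠ 0) :
    lineProj (.mk 𝕜 u hu) *ᵥ u = u := by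
  rw [lineProj_mk_mulVec, inv_mul_cancel₀ (dotProduct_star_self_eq_zero.not.2 hu), one_smul]

theorem lineProj_mk_mulVec_eq_zero_iff {u : ι → 𝕜} (hu : u ≠ 0) {v : ι → 𝕜} :
    lineProj (.mk 𝕜 u hu) *ᵥ v = 0 ↔ star u ⬝ᵥ v = 0 := by
  simp [lineProj_mk_mulVec, hu]

theorem lineProj_ne_zero (l : ℙ 𝕜 (ι → 𝕜)) : lineProj l ≠ 0 := by
  induction l with
  | h u hu =>
    intro h
    exact hu (by rw [← lineProj_mk_mulVec_self u hu, h, zero_mulVec])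

theorem isIdempotentElem_lineProj (l : ℙ 𝕜 (ι → 𝕜)) : IsIdempotentElem (lineProj l) := by
  induction l with
  | h u hu =>
    rw [IsIdempotentElem]
    conv_lhs => enter [2]; rw [lineProj_mk]
    rw [Matrix.mul_smul, mul_vecMulVec, lineProj_mk_mulVec_self, lineProj_mk]

theorem isHermitian_lineProj (l : ℙ 𝕜 (ι → 𝕜)) : (lineProj l).IsHermitian := by
  induction l with
  | h u hu =>
    rw [IsHermitian, lineProj_mk, conjTranspose_smul, conjTranspose_vecMulVec, star_star, star_inv₀,
      ← star_dotProduct]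

theorem eq_of_lineProj_mulVec_eq_zero {l l' : ℙ 𝕜 (ι → 𝕜)}
    (h : ∀ v, lineProj l *ᵥ v = 0 → lineProj l' *ᵥ v = 0) : l = l' := by
  classical
  have hmul : lineProj l' * (1 - lineProj l) = 0 := by
    refine ext_of_mulVec_single fun i => ?_
    rw [← mulVec_mulVec, zero_mulVec]
    apply h
    rw [mulVec_mulVec, mul_sub, mul_one, (isIdempotentElem_lineProj l).eq, sub_self, zero_mulVec]
  have hfix : lineProj l * lineProj l' = lineProj l' := by
    have := congrArg conjTranspose hmul
    rw [mul_sub, mul_one, conjTranspose_sub, conjTranspose_mul, (isHermitian_lineProj l).eq,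
      (isHermitian_lineProj l').eq, conjTranspose_zero, sub_eq_zero] at this
    exact this.symm
  induction l with
  | h u hu =>
  induction l' with
  | h u' hu' =>
    have hu'P : lineProj (.mk 𝕜 u hu) *ᵥ u' = u' := by
      rw [← lineProj_mk_mulVec_self u' hu', mulVec_mulVec, hfix]
    rw [lineProj_mk_mulVec] at hu'P
    exact ((Projectivization.mk_eq_mk_iff' _ _ _ _ _).2 ⟨_, hu'P⟩).symm

theorem lineProj_injective : Function.Injective (lineProj : ℙ 𝕜 (ι → 𝕜) → Matrix ι ι 𝕜) :=
  fun _ _ h => eq_of_lineProj_mulVec_eq_zero fun _ hv => h ▸ hv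

theorem continuous_lineProj : Continuous (lineProj : ℙ 𝕜 (ι → 𝕜) → Matrix ι ι 𝕜) := by
  refine isOpenQuotientMap_projectivization_mk'.isQuotientMap.continuous_iff.2 ?_
  have hval : Continuous fun u : {v : ι → 𝕜 // v ≠ 0} => (u : ι → 𝕜) := continuous_subtype_val
  refine .smul (.inv₀ (hval.star.dotProduct hval) fun u => ?_) (hval.matrix_vecMulVec hval.star)
  exact dotProduct_star_self_eq_zero.not.2 u.2

instance {𝕜 ι : Type*} [RCLike 𝕜] [Finite ι] : T2Space (ℙ 𝕜 (ι → 𝕜)) :=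
  have := Fintype.ofFinite ι
  .of_injective_continuous lineProj_injective continuous_lineProj

theorem exists_lineProj_mulVec_eq_zero_iff_mem {W : Submodule 𝕜 (ι → 𝕜)} (hW : IsCoatom W) :
    ∃ l : ℙ 𝕜 (ι → 𝕜), ∀ v, lineProj l *ᵥ v = 0 ↔ v ∈ W := by
  classical
  obtain ⟨f, hf0, hf⟩ := W.exists_le_ker_of_lt_top hW.lt_top
  have hker : LinearMap.ker f = W :=
    (hW.le_iff.1 hf).resolve_left (LinearMap.ker_eq_top.not.2 hf0)
  obtain ⟨w, rfl⟩ := (dotProductEquiv 𝕜 ι).surjective f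
  have hw : star w ≠ 0 := by simpa using hf0
  refine ⟨.mk 𝕜 (star w) hw, fun v => ?_⟩
  rw [lineProj_mk_mulVec_eq_zero_iff, star_star, ← hker, LinearMap.mem_ker,
    dotProductEquiv_apply_apply]

theorem mul_lineProj_mul_eq_zero {A B : Matrix ι ι 𝕜} {l : ℙ 𝕜 (ι → 𝕜)}
    (h : A * lineProj l * B = 0) : A * lineProj l = 0 ∨ lineProj l * B = 0 := by
  induction l with
  | h u hu =>
    have hc : (star u ⬝ᵥ u)⁻¹ ≠ 0 := inv_ne_zero (dotProduct_star_self_eq_zero.not.2 hu)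
    simpa only [lineProj_mk, Matrix.mul_smul, Matrix.smul_mul, mul_vecMulVec, vecMulVec_mul,
      smul_eq_zero, hc, false_or, vecMulVec_eq_zero, star_eq_zero, hu, or_false] using h

theorem exists_lineProj_mul_lineProj_eq_zero {m : ℕ} [DecidableEq ι]
    {l : Fin (m + 1) → ℙ 𝕜 (ι → 𝕜)} (h : (List.ofFn fun i => lineProj (l i)).prod = 0) :
    ∃ i : Fin m, lineProj (l i.castSucc) * lineProj (l i.succ) = 0 := by
  induction m with
  | zero => exact absurd (by simpa using h) (lineProj_ne_zero (l 0))
  | succ m ih =>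
    rw [List.ofFn_succ, List.prod_cons, List.ofFn_succ, List.prod_cons, ← mul_assoc] at h
    rcases mul_lineProj_mul_eq_zero h with h | h
    · exact ⟨0, h⟩
    · obtain ⟨i, hi⟩ := ih (l := fun i => l i.succ) (by rwa [List.ofFn_succ, List.prod_cons])
      exact ⟨i.succ, hi⟩

end LineProj

section Perp

variable {𝕜 : Type*} [RCLike 𝕜]

/-- The conjugate-linear map of `𝕜 ^ 2` that sends each vector to one orthogonal to it. -/
def perpVec : (Fin 2 → 𝕜) →ₛₗ[starRingEnd 𝕜] (Fin 2 → 𝕜) where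
  toFun u := ![-star (u 1), star (u 0)]
  map_add' u v := by ext i; fin_cases i <;> simp [add_comm]
  map_smul' c u := by ext i; fin_cases i <;> simp

theorem perpVec_injective : Function.Injective (perpVec : (Fin 2 → 𝕜) → Fin 2 → 𝕜) := by
  intro u v h
  have h0 : -star (u 1) = -star (v 1) := congrFun h 0
  have h1 : star (u 0) = star (v 0) := congrFun h 1
  ext i
  fin_cases i
  · exact star_injective h1
  · exact star_injective (neg_injective h0)

theorem continuous_perpVec : Continuous (perpVec : (Fin 2 → 𝕜) → Fin 2 → 𝕜) :=
  continuous_pi <| Fin.forall_fin_two.2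
    ⟨(continuous_apply 1).star.neg, (continuous_apply 0).star⟩

/-- The orthogonal complement of a line in `𝕜 ^ 2`, as a self-map of the projective line. -/
def perp : ℙ 𝕜 (Fin 2 → 𝕜) → ℙ 𝕜 (Fin 2 → 𝕜) :=
  Projectivization.map perpVec perpVec_injective

theorem continuous_perp : Continuous (perp : ℙ 𝕜 (Fin 2 → 𝕜) → ℙ 𝕜 (Fin 2 → 𝕜)) :=
  continuous_projectivization_map perpVec_injective continuous_perpVec

theorem lineProj_perp (l : ℙ 𝕜 (Fin 2 → 𝕜)) : lineProj (perp l) = 1 - lineProj l := by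
  induction l with
  | h u hu =>
    have hnorm : star (perpVec u) ⬝ᵥ perpVec u = star u ⬝ᵥ u := by
      simp [dotProduct, perpVec, mul_comm, add_comm]
    have hsum : vecMulVec (perpVec u) (star (perpVec u)) + vecMulVec u (star u) =
        (star u ⬝ᵥ u) • 1 := by
      ext i j
      rw [Matrix.add_apply, Matrix.smul_apply, vecMulVec_apply, vecMulVec_apply]
      fin_cases i <;> fin_cases j <;>
        simp [dotProduct, perpVec, mul_comm, add_comm]
    rw [perp, Projectivization.map_mk, lineProj_mk, lineProj_mk, hnorm, eq_sub_iff_add_eq,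
      ← smul_add, hsum, inv_smul_smul₀ (dotProduct_star_self_eq_zero.not.2 hu)]

theorem perp_involutive : Function.Involutive (perp : ℙ 𝕜 (Fin 2 → 𝕜) → _) := fun l =>
  lineProj_injective (by rw [lineProj_perp, lineProj_perp, sub_sub_cancel])

theorem lineProj_mul_lineProj_eq_zero_iff {l l' : ℙ 𝕜 (Fin 2 → 𝕜)} :
    lineProj l * lineProj l' = 0 ↔ l' = perp l := by
  constructor
  · intro h
    suffices perp l' = l by rw [← this, perp_involutive]
    refine eq_of_lineProj_mulVec_eq_zero fun v hv => ?_
    rw [lineProj_perp, sub_mulVec, one_mulVec, sub_eq_zero] at hv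
    rw [hv, mulVec_mulVec, h, zero_mulVec]
  · rintro rfl
    rw [lineProj_perp, mul_sub, mul_one, (isIdempotentElem_lineProj l).eq, sub_self]

end Perp

section Series

variable {R V W : Type*} [Ring R] [AddCommGroup V] [Module R V] [AddCommGroup W] [Module R W]

theorem comap_covBy_comap {f : V →ₗ[R] W} {M N : Submodule R W} (h : M ⋖ N)
    (hN : N ≤ LinearMap.range f) : M.comap f ⋖ N.comap f := by
  have hmap {P : Submodule R W} (hP : P ≤ N) : (P.comap f).map f = P :=
    Submodule.map_comap_eq_of_le (hP.trans hN)
  refine covBy_iff_lt_and_eq_or_eq.2 ⟨lt_of_le_of_ne (Submodule.comap_mono h.le) fun heq => ?_,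
    fun K hMK hKN => ?_⟩
  · exact h.lt.ne (by rw [← hmap h.le, heq, hmap le_rfl])
  · have hK : (K.map f).comap f = K := Submodule.comap_map_eq_self <|
      (Submodule.comap_mono bot_le).trans hMK
    have hM : M ≤ K.map f := hmap h.le ▸ Submodule.map_mono hMK
    exact (h.eq_or_eq hM (Submodule.map_le_iff_le_comap.2 hKN)).imp
      (fun h => by rw [← hK, h]) fun h => by rw [← hK, h]

theorem range_le_of_isCoatom {f : End R V} {N : Submodule R V} (hN : IsCoatom N)
    (hf : N ≤ N.comap f) {n : ℕ} (hn : LinearMap.range (f ^ n) ≤ N) : LinearMap.range f ≤ N := by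
  by_contra hle
  have htop : LinearMap.range f ⊔ N = ⊤ := hN.2 _ (right_lt_sup.2 hle)
  suffices LinearMap.range (f ^ n) ⊔ N = ⊤ from hN.1 (by rwa [sup_eq_right.2 hn] at this)
  clear hn
  induction n with
  | zero => simp [Module.End.one_eq_id]
  | succ n ih =>
    calc
      LinearMap.range (f ^ (n + 1)) ⊔ N = LinearMap.range (f ^ (n + 1)) ⊔ (N.map f ⊔ N) := by
        rw [sup_eq_right.2 (Submodule.map_le_iff_le_comap.2 hf)]
      _ = (LinearMap.range (f ^ n) ⊔ N).map f ⊔ N := by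
        rw [Submodule.map_sup, sup_assoc, pow_succ', Module.End.mul_eq_comp, LinearMap.range_comp]
      _ = ⊤ := by rw [ih, Submodule.map_top, htop]

/-- Multiplication by `t` on `V⟦t⟧`, where a series is encoded as the sequence of its
coefficients. -/
def shift : End R (ℕ → V) where
  toFun x k := k.casesOn 0 x
  map_add' x y := by ext k; cases k <;> simp
  map_smul' c x := by ext k; cases k <;> simp

@[simp]
theorem shift_apply_zero (x : ℕ → V) : shift (R := R) x 0 = 0 := rfl

@[simp]
theorem shift_apply_succ (x : ℕ → V) (k : ℕ) : shift (R := R) x (k + 1) = x k := rfl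

theorem shift_injective : Function.Injective (shift : End R (ℕ → V)) := fun _ _ h =>
  funext fun k => congrFun h (k + 1)

theorem mem_range_shift_pow {n : ℕ} {x : ℕ → V} :
    x ∈ LinearMap.range ((shift : End R (ℕ → V)) ^ n) ↔ ∀ k < n, x k = 0 := by
  induction n generalizing x with
  | zero => simp
  | succ n ih =>
    rw [pow_succ']
    constructor
    · rintro ⟨y, rfl⟩ (_ | k) hk
      · rfl
      · exact ih.1 ⟨y, rfl⟩ k (by lia)
    · intro h
      obtain ⟨y, hy⟩ := (ih (x := fun k => x (k + 1))).2 fun k hk => h (k + 1) (by lia)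
      refine ⟨y, funext ?_⟩
      rintro (_ | k)
      · exact (h 0 (by lia)).symm
      · exact congrFun hy k

theorem ker_proj_zero_eq_range_shift : LinearMap.ker (LinearMap.proj 0 : (ℕ → V) →ₗ[R] V) =
    LinearMap.range (shift : End R (ℕ → V)) := by
  ext x
  rw [← pow_one shift, mem_range_shift_pow]
  simp

/-- The elementary factor `(1 - P) + t P` attached to an endomorphism `P` of `V`, acting on
`V⟦t⟧`. -/
def elemFactor (P : End R V) : End R (ℕ → V) :=
  (1 - P).compLeft ℕ + P.compLeft ℕ * shift

theorem elemFactor_apply (P : End R V) (x : ℕ → V) (k : ℕ) :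
    elemFactor P x k = x k - P (x k) + P (shift (R := R) x k) := rfl

theorem elemFactor_apply_zero (P : End R V) (x : ℕ → V) :
    elemFactor P x 0 = (1 - P) (x 0) := by
  simp [elemFactor_apply]

theorem commute_shift_elemFactor (P : End R V) : Commute shift (elemFactor P) := by
  refine LinearMap.ext fun x => funext fun k => ?_
  cases k <;> simp [elemFactor_apply]

variable {P : End R V}

theorem elemFactor_mul_elemFactor_one_sub (hP : IsIdempotentElem P) :
    elemFactor P * elemFactor (1 - P) = shift := by
  have hPP (v : V) : P (P v) = P v := LinearMap.congr_fun hP.eq v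
  refine LinearMap.ext fun x => funext fun k => ?_
  cases k <;> simp [elemFactor_apply, hPP]

theorem elemFactor_injective (hP : IsIdempotentElem P) : Function.Injective (elemFactor P) := by
  have h := elemFactor_mul_elemFactor_one_sub hP.one_sub
  rw [sub_sub_cancel] at h
  refine Function.Injective.of_comp (f := elemFactor (1 - P)) ?_
  rw [← Module.End.coe_mul, h]
  exact shift_injective

theorem mem_range_elemFactor (hP : IsIdempotentElem P) {x : ℕ → V} :
    x ∈ LinearMap.range (elemFactor P) ↔ P (x 0) = 0 := by
  have hPP (v : V) : P (P v) = P v := LinearMap.congr_fun hP.eq v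
  constructor
  · rintro ⟨y, rfl⟩
    simp [elemFactor_apply, hPP]
  · intro h
    refine ⟨fun k => x k - P (x k) + P (x (k + 1)), funext fun k => ?_⟩
    cases k <;> simp [elemFactor_apply, hPP, h]

end Series

section Lattice

variable {𝕜 ι : Type*} [RCLike 𝕜] [Fintype ι] {m n : ℕ}

theorem isIdempotentElem_mulVecLin_lineProj (l : ℙ 𝕜 (ι → 𝕜)) :
    IsIdempotentElem (lineProj l).mulVecLin := by
  rw [IsIdempotentElem, Module.End.mul_eq_comp, ← mulVecLin_mul, (isIdempotentElem_lineProj l).eq]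

/-- The elementary factor of a line, which multiplies by `t` along the line and is the identity on
its orthogonal complement. -/
noncomputable def lineFactor (l : ℙ 𝕜 (ι → 𝕜)) : End 𝕜 (ℕ → ι → 𝕜) :=
  elemFactor (lineProj l).mulVecLin

theorem mem_range_lineFactor {l : ℙ 𝕜 (ι → 𝕜)} {x : ℕ → ι → 𝕜} :
    x ∈ LinearMap.range (lineFactor l) ↔ lineProj l *ᵥ x 0 = 0 :=
  mem_range_elemFactor (isIdempotentElem_mulVecLin_lineProj l)

theorem exists_eq_range_lineFactor {N : Submodule 𝕜 (ℕ → ι → 𝕜)} (hN : IsCoatom N)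
    (hshift : N ≤ N.comap shift) (hn : LinearMap.range (shift ^ n) ≤ N) :
    ∃ l, N = LinearMap.range (lineFactor l) := by
  let eval : (ℕ → ι → 𝕜) →ₗ[𝕜] ι → 𝕜 := LinearMap.proj 0
  have hker : LinearMap.ker eval ≤ N :=
    ker_proj_zero_eq_range_shift.trans_le (range_le_of_isCoatom hN hshift hn)
  obtain ⟨l, hl⟩ := exists_lineProj_mulVec_eq_zero_iff_mem
    (Submodule.isCoatom_map_of_ker_le (LinearMap.proj_surjective 0) hker hN)
  refine ⟨l, Submodule.ext fun x => ?_⟩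
  rw [mem_range_lineFactor, hl]
  conv_lhs => rw [← Submodule.comap_map_eq_self hker]
  rfl

/-- The product of the elementary factors of the first `j` of the lines `l`. -/
noncomputable def factorProd (l : Fin m → ℙ 𝕜 (ι → 𝕜)) (j : Fin (m + 1)) : End 𝕜 (ℕ → ι → 𝕜) :=
  Fin.partialProd (fun i => lineFactor (l i)) j

@[simp]
theorem factorProd_zero (l : Fin m → ℙ 𝕜 (ι → 𝕜)) : factorProd l 0 = 1 :=
  Fin.partialProd_zero _

theorem factorProd_succ (l : Fin m → ℙ 𝕜 (ι → 𝕜)) (i : Fin m) :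
    factorProd l i.succ = factorProd l i.castSucc * lineFactor (l i) :=
  Fin.partialProd_succ _ _

theorem factorProd_succ' (l : Fin (m + 1) → ℙ 𝕜 (ι → 𝕜)) (j : Fin (m + 1)) :
    factorProd l j.succ = lineFactor (l 0) * factorProd (Fin.tail l) j :=
  Fin.partialProd_succ' _ _

theorem commute_shift_factorProd (l : Fin m → ℙ 𝕜 (ι → 𝕜)) (j : Fin (m + 1)) :
    Commute shift (factorProd l j) := by
  induction j using Fin.induction with
  | zero => exact factorProd_zero l ▸ Commute.one_right _
  | succ i ih => exact factorProd_succ l i ▸ ih.mul_right (commute_shift_elemFactor _)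

theorem lineFactor_injective (l : ℙ 𝕜 (ι → 𝕜)) : Function.Injective (lineFactor l) :=
  elemFactor_injective (isIdempotentElem_mulVecLin_lineProj l)

theorem factorProd_injective (l : Fin m → ℙ 𝕜 (ι → 𝕜)) (j : Fin (m + 1)) :
    Function.Injective (factorProd l j) := by
  induction j using Fin.induction with
  | zero => exact factorProd_zero l ▸ Function.injective_id
  | succ i ih => exact factorProd_succ l i ▸ ih.comp (lineFactor_injective _)

theorem continuous_factorProd_apply {X : Type*} [TopologicalSpace X]
    {l : X → Fin m → ℙ 𝕜 (ι → 𝕜)} {x : X → ℕ → ι → 𝕜} (hl : Continuous l) (hx : Continuous x)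
    (j : Fin (m + 1)) : Continuous fun t => factorProd (l t) j (x t) := by
  induction j using Fin.induction generalizing x with
  | zero => simpa using hx
  | succ i ih =>
    simp only [factorProd_succ, Module.End.mul_apply]
    refine ih (continuous_pi fun k => ?_)
    have hP : Continuous fun t => lineProj (l t i) := continuous_lineProj.comp (by fun_prop)
    have hk : Continuous fun t => x t k := by fun_prop
    have hshift : Continuous fun t => shift (R := 𝕜) (x t) k := by
      cases k <;> simp only [shift_apply_zero, shift_apply_succ] <;> fun_prop
    exact (hk.sub (hP.matrix_mulVec hk)).add (hP.matrix_mulVec hshift)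

/-- The lattice in `𝕜⟦t⟧ ^ ι` reached from the standard one by the elementary factors of the first
`j` of the lines `l`. -/
noncomputable def lattice (l : Fin m → ℙ 𝕜 (ι → 𝕜)) (j : Fin (m + 1)) :
    Submodule 𝕜 (ℕ → ι → 𝕜) :=
  LinearMap.range (factorProd l j)

@[simp]
theorem lattice_zero (l : Fin m → ℙ 𝕜 (ι → 𝕜)) : lattice l 0 = ⊤ := by
  simp [lattice, Module.End.one_eq_id]

theorem lattice_succ (l : Fin (m + 1) → ℙ 𝕜 (ι → 𝕜)) (j : Fin (m + 1)) :
    lattice l j.succ = (lattice (Fin.tail l) j).map (lineFactor (l 0)) := by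
  rw [lattice, factorProd_succ', Module.End.mul_eq_comp, LinearMap.range_comp, lattice]

theorem lattice_le_comap_shift (l : Fin m → ℙ 𝕜 (ι → 𝕜)) (j : Fin (m + 1)) :
    lattice l j ≤ (lattice l j).comap shift := by
  rintro _ ⟨x, rfl⟩
  exact ⟨shift x, (LinearMap.congr_fun (commute_shift_factorProd l j) x).symm⟩

theorem factorProd_mem_lattice_succ {l : Fin m → ℙ 𝕜 (ι → 𝕜)} {i : Fin m} {x : ℕ → ι → 𝕜} :
    factorProd l i.castSucc x ∈ lattice l i.succ ↔ lineProj (l i) *ᵥ x 0 = 0 := by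
  rw [← mem_range_lineFactor, lattice, factorProd_succ, Module.End.mul_eq_comp,
    LinearMap.range_comp]
  exact (factorProd_injective l _).mem_set_image

theorem lattice_strictAnti (l : Fin m → ℙ 𝕜 (ι → 𝕜)) : StrictAnti (lattice l) := by
  refine Fin.strictAnti_iff_succ_lt.2 fun i => ?_
  refine lt_of_le_not_ge ?_ fun h => ?_
  · rw [lattice, factorProd_succ]
    exact LinearMap.range_comp_le_range _ _
  · obtain ⟨v, hv⟩ : ∃ v, lineProj (l i) *ᵥ v ≠ 0 := by
      by_contra! hzero
      exact lineProj_ne_zero (l i) (mulVec_injective (funext fun v => by simp [hzero]))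
    exact hv (factorProd_mem_lattice_succ.1 (h ⟨fun _ => v, rfl⟩))

theorem lattice_injective :
    Function.Injective (lattice : (Fin m → ℙ 𝕜 (ι → 𝕜)) → _) := by
  intro l l' h
  induction m with
  | zero => exact Subsingleton.elim _ _
  | succ m ih =>
    have h0 : l 0 = l' 0 := by
      refine eq_of_lineProj_mulVec_eq_zero fun v hv => ?_
      have mem_iff (l : Fin (m + 1) → ℙ 𝕜 (ι → 𝕜)) :
          (fun _ => v) ∈ lattice l (Fin.succ 0) ↔ lineProj (l 0) *ᵥ v = 0 := by
        simpa using factorProd_mem_lattice_succ (l := l) (i := 0) (x := fun _ => v)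
      rwa [← mem_iff, ← h, mem_iff]
    have htail : Fin.tail l = Fin.tail l' := by
      refine ih (funext fun j => ?_)
      have := congrFun h j.succ
      rw [lattice_succ, lattice_succ, h0] at this
      exact Submodule.map_injective_of_injective (lineFactor_injective _) this
    rw [← Fin.cons_self_tail l, ← Fin.cons_self_tail l', h0, htail]

theorem exists_eq_lattice {N : Fin (m + 1) → Submodule 𝕜 (ℕ → ι → 𝕜)} (h0 : N 0 = ⊤)
    (hcov : ∀ i : Fin m, N i.succ ⋖ N i.castSucc) (hshift : ∀ j, N j ≤ (N j).comap shift)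
    (hn : ∀ j, LinearMap.range (shift ^ n) ≤ N j) : ∃ l, N = lattice l := by
  induction m with
  | zero => exact ⟨Fin.elim0, funext <| Fin.forall_fin_one.2 (by rw [h0, lattice_zero])⟩
  | succ m ih =>
    have hcoatom : IsCoatom (N 1) := by simpa [h0, covBy_top_iff] using hcov 0
    obtain ⟨l₀, hl₀⟩ := exists_eq_range_lineFactor hcoatom (hshift 1) (hn 1)
    have hanti : Antitone N := Fin.antitone_iff_succ_le.2 fun i => (hcov i).le
    have hle (j : Fin (m + 1)) : N j.succ ≤ LinearMap.range (lineFactor l₀) :=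
      hl₀ ▸ hanti (Fin.succ_le_succ_iff.2 (Fin.zero_le j))
    have hcomm : Commute shift (lineFactor l₀) := commute_shift_elemFactor _
    have hshift' (j : Fin (m + 1)) : (N j.succ).comap (lineFactor l₀) ≤
        ((N j.succ).comap (lineFactor l₀)).comap shift := by
      rw [← Submodule.comap_comp, ← Module.End.mul_eq_comp, ← hcomm.eq, Module.End.mul_eq_comp,
        Submodule.comap_comp]
      exact Submodule.comap_mono (hshift _)
    have hn' (j : Fin (m + 1)) :
        LinearMap.range (shift ^ n) ≤ (N j.succ).comap (lineFactor l₀) := by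
      rw [← Submodule.map_le_iff_le_comap, ← LinearMap.range_comp, ← Module.End.mul_eq_comp,
        ← (hcomm.pow_left n).eq]
      exact (LinearMap.range_comp_le_range _ _).trans (hn _)
    have htop : (N (Fin.succ 0)).comap (lineFactor l₀) = ⊤ :=
      LinearMap.range_le_iff_comap.1 hl₀.ge
    obtain ⟨l, hl⟩ := ih (N := fun j => (N j.succ).comap (lineFactor l₀)) htop
      (fun i => comap_covBy_comap (hcov i.succ) (hle i.castSucc)) hshift' hn'
    refine ⟨Fin.cons l₀ l, funext <| Fin.cases (by rw [h0, lattice_zero]) fun j => ?_⟩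
    rw [lattice_succ, Fin.tail_cons, Fin.cons_zero, ← hl, Submodule.map_comap_eq_of_le (hle j)]

/-- The sequences of lines whose lattices lead down to the standard lattice multiplied by
`t ^ n`: a fibre of the convolution morphism to the affine Grassmannian. -/
def convolutionFiber (𝕜 ι : Type*) [RCLike 𝕜] [Fintype ι] (m n : ℕ) :
    Set (Fin m → ℙ 𝕜 (ι → 𝕜)) :=
  {l | lattice l (Fin.last m) = LinearMap.range (shift ^ n)}

end Lattice

section Skip

variable {m : ℕ}

/-- The increasing map onto the complement of the two adjacent points `i` and `i + 1`. -/
def skip (i : Fin (m + 1)) (k : Fin m) : Fin (m + 2) :=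
  i.castSucc.succAbove (i.succAbove k)

theorem val_skip (i : Fin (m + 1)) (k : Fin m) :
    (skip i k : ℕ) = if (k : ℕ) < i then (k : ℕ) else k + 2 := by
  simp only [skip, Fin.succAbove, Fin.lt_def]
  split_ifs <;> simp_all
  lia

theorem skip_strictMono (i : Fin (m + 1)) : StrictMono (skip i) :=
  (Fin.strictMono_succAbove _).comp (Fin.strictMono_succAbove _)

theorem skip_ne_castSucc (i : Fin (m + 1)) (k : Fin m) : skip i k ≠ i.castSucc :=
  Fin.succAbove_ne _ _

theorem skip_ne_succ (i : Fin (m + 1)) (k : Fin m) : skip i k ≠ i.succ := by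
  rw [← Fin.succAbove_castSucc_self]
  exact Fin.succAbove_right_injective.ne (Fin.succAbove_ne _ _)

theorem eq_castSucc_or_eq_succ_or_eq_skip (i : Fin (m + 1)) (j : Fin (m + 2)) :
    j = i.castSucc ∨ j = i.succ ∨ ∃ k, j = skip i k := by
  obtain rfl | ⟨j, rfl⟩ := Fin.eq_self_or_eq_succAbove i.castSucc j
  · exact .inl rfl
  obtain rfl | ⟨k, rfl⟩ := Fin.eq_self_or_eq_succAbove i j
  · exact .inr (.inl (Fin.succAbove_castSucc_self _))
  · exact .inr (.inr ⟨k, rfl⟩)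

theorem skip_succ_zero (i : Fin (m + 1)) : skip i.succ 0 = 0 :=
  Fin.ext (by simp [val_skip])

theorem skip_succ_succ (i : Fin (m + 1)) (k : Fin m) : skip i.succ k.succ = (skip i k).succ := by
  ext
  simp only [val_skip, Fin.val_succ]
  split_ifs <;> lia

end Skip

section Plane

variable {𝕜 : Type*} [RCLike 𝕜] {m n : ℕ}

theorem lineFactor_mul_lineFactor_perp (l : ℙ 𝕜 (Fin 2 → 𝕜)) :
    lineFactor l * lineFactor (perp l) = shift := by
  have hperp : (lineProj (perp l)).mulVecLin = 1 - (lineProj l).mulVecLin :=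
    LinearMap.ext fun v => by simp [lineProj_perp]
  rw [lineFactor, lineFactor, hperp,
    elemFactor_mul_elemFactor_one_sub (isIdempotentElem_mulVecLin_lineProj l)]

theorem factorProd_last_succ {ι : Type*} [Fintype ι] (l : Fin (m + 1) → ℙ 𝕜 (ι → 𝕜)) :
    factorProd l (Fin.last (m + 1)) = lineFactor (l 0) * factorProd (Fin.tail l) (Fin.last m) :=
  factorProd_succ' l (Fin.last m)

theorem factorProd_last_of_eq_perp {l : Fin (m + 2) → ℙ 𝕜 (Fin 2 → 𝕜)} {i : Fin (m + 1)}
    (h : l i.succ = perp (l i.castSucc)) :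
    factorProd l (Fin.last (m + 2)) = shift * factorProd (l ∘ skip i) (Fin.last m) := by
  have zero_case {m : ℕ} {l : Fin (m + 2) → ℙ 𝕜 (Fin 2 → 𝕜)} (h : l 1 = perp (l 0)) :
      factorProd l (Fin.last (m + 2)) = shift * factorProd (l ∘ skip 0) (Fin.last m) := by
    rw [factorProd_last_succ, factorProd_last_succ, ← mul_assoc, Fin.tail, Fin.succ_zero_eq_one, h,
      lineFactor_mul_lineFactor_perp]
    rfl
  induction m with
  | zero =>
    obtain rfl : i = 0 := Fin.fin_one_eq_zero i
    exact zero_case h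
  | succ m ih =>
    cases i using Fin.cases with
    | zero => exact zero_case h
    | succ i =>
      have htail : Fin.tail (l ∘ skip i.succ) = Fin.tail l ∘ skip i :=
        funext fun k => congrArg l (skip_succ_succ i k)
      have hcomm : Commute shift (lineFactor (l 0)) := commute_shift_elemFactor _
      rw [factorProd_last_succ, ih (l := Fin.tail l) h, factorProd_last_succ, htail,
        Function.comp_apply, skip_succ_zero, ← mul_assoc, ← mul_assoc, hcomm.eq]

theorem factorProd_last_apply_zero {ι : Type*} [Fintype ι] [DecidableEq ι]
    (l : Fin m → ℙ 𝕜 (ι → 𝕜)) (x : ℕ → ι → 𝕜) :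
    factorProd l (Fin.last m) x 0 = (List.ofFn fun i => 1 - lineProj (l i)).prod *ᵥ x 0 := by
  induction m with
  | zero => simp
  | succ m ih =>
    rw [factorProd_last_succ, Module.End.mul_apply, lineFactor, elemFactor_apply_zero, ih,
      List.ofFn_succ, List.prod_cons, ← mulVec_mulVec, sub_mulVec, one_mulVec]
    rfl

theorem exists_eq_perp_of_range_le_range_shift {l : Fin (m + 1) → ℙ 𝕜 (Fin 2 → 𝕜)}
    (h : LinearMap.range (factorProd l (Fin.last (m + 1))) ≤ LinearMap.range shift) :
    ∃ i : Fin m, l i.succ = perp (l i.castSucc) := by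
  have hprod : (List.ofFn fun i => lineProj (perp (l i))).prod = 0 := by
    refine mulVec_injective (funext fun v => ?_)
    obtain ⟨y, hy⟩ := h ⟨fun _ => v, rfl⟩
    simp only [lineProj_perp]
    rw [← factorProd_last_apply_zero l fun _ => v, ← hy, shift_apply_zero, zero_mulVec]
  obtain ⟨i, hi⟩ := exists_lineProj_mul_lineProj_eq_zero hprod
  exact ⟨i, perp_involutive.injective (lineProj_mul_lineProj_eq_zero_iff.1 hi)⟩

theorem mem_convolutionFiber_succ {l : Fin (m + 2) → ℙ 𝕜 (Fin 2 → 𝕜)} :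
    l ∈ convolutionFiber 𝕜 (Fin 2) (m + 2) (n + 1) ↔ ∃ i : Fin (m + 1),
      l i.succ = perp (l i.castSucc) ∧ l ∘ skip i ∈ convolutionFiber 𝕜 (Fin 2) m n := by
  have remove {i : Fin (m + 1)} (hi : l i.succ = perp (l i.castSucc)) :
      l ∈ convolutionFiber 𝕜 (Fin 2) (m + 2) (n + 1) ↔
        l ∘ skip i ∈ convolutionFiber 𝕜 (Fin 2) m n := by
    rw [convolutionFiber, Set.mem_ofPred, lattice, factorProd_last_of_eq_perp hi, pow_succ',
      Module.End.mul_eq_comp, Module.End.mul_eq_comp, LinearMap.range_comp, LinearMap.range_comp]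
    exact (Submodule.map_injective_of_injective shift_injective).eq_iff
  refine ⟨fun hl => ?_, fun ⟨i, hi, hl⟩ => (remove hi).2 hl⟩
  obtain ⟨i, hi⟩ := exists_eq_perp_of_range_le_range_shift (l := l) <| hl.le.trans <| by
    rw [pow_succ']
    exact LinearMap.range_comp_le_range _ _
  exact ⟨i, hi, (remove hi).1 hl⟩

/-- The self-map of the space of sequences of lines that replaces every second line by its
orthogonal complement. -/
def alternate (l : Fin m → ℙ 𝕜 (Fin 2 → 𝕜)) (j : Fin m) : ℙ 𝕜 (Fin 2 → 𝕜) :=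
  if Even (j : ℕ) then l j else perp (l j)

theorem alternate_involutive :
    Function.Involutive (alternate : (Fin m → ℙ 𝕜 (Fin 2 → 𝕜)) → Fin m → ℙ 𝕜 (Fin 2 → 𝕜)) := by
  intro l
  ext1 j
  by_cases h : Even (j : ℕ) <;> simp [alternate, h, perp_involutive _]

theorem continuous_alternate :
    Continuous (alternate : (Fin m → ℙ 𝕜 (Fin 2 → 𝕜)) → Fin m → ℙ 𝕜 (Fin 2 → 𝕜)) := by
  refine continuous_pi fun j => ?_
  unfold alternate
  split_ifs
  · exact continuous_apply j
  · exact continuous_perp.comp (continuous_apply j)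

theorem alternate_comp_skip (l : Fin (m + 2) → ℙ 𝕜 (Fin 2 → 𝕜)) (i : Fin (m + 1)) :
    alternate (l ∘ skip i) = alternate l ∘ skip i := by
  ext1 k
  have hparity : Even (skip i k : ℕ) ↔ Even (k : ℕ) := by
    rw [val_skip]
    split_ifs <;> simp [Nat.even_add]
  simp only [alternate, Function.comp_apply, hparity]

theorem alternate_succ_eq_perp_iff (l : Fin (m + 1) → ℙ 𝕜 (Fin 2 → 𝕜)) (i : Fin m) :
    alternate l i.succ = perp (alternate l i.castSucc) ↔ l i.castSucc = l i.succ := by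
  by_cases h : Even (i : ℕ)
  · simp [alternate, h, Nat.even_add_one, perp_involutive.injective.eq_iff, eq_comm]
  · simp [alternate, h, Nat.even_add_one, perp_involutive _, eq_comm]

end Plane

section InsertPartner

variable {m : ℕ}

/-- The extension of a pairing `p` along `skip i` that pairs the two new points `i` and
`i + 1`. -/
def insertPartner (p : Fin m → Fin m) (i : Fin (m + 1)) : Fin (m + 2) → Fin (m + 2) :=
  i.castSucc.insertNth i.succ (i.insertNth i.castSucc (skip i ∘ p))

theorem insertPartner_castSucc (p : Fin m → Fin m) (i : Fin (m + 1)) :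
    insertPartner p i i.castSucc = i.succ :=
  Fin.insertNth_apply_same ..

theorem insertPartner_succ (p : Fin m → Fin m) (i : Fin (m + 1)) :
    insertPartner p i i.succ = i.castSucc := by
  rw [insertPartner]
  conv_lhs => enter [4]; rw [← Fin.succAbove_castSucc_self]
  rw [Fin.insertNth_apply_succAbove, Fin.insertNth_apply_same]

theorem insertPartner_skip (p : Fin m → Fin m) (i : Fin (m + 1)) (k : Fin m) :
    insertPartner p i (skip i k) = skip i (p k) := by
  rw [insertPartner, skip, Fin.insertNth_apply_succAbove, Fin.insertNth_apply_succAbove,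
    Function.comp_apply]

end InsertPartner

namespace CrossinglessMatching

variable {n : ℕ}

theorem mem_subspace_iff {a : CrossinglessMatching n} {l : Fin (2 * n) → ComplexProjectiveLine} :
    l ∈ a.subspace ↔ ∀ j, l (a.partner j) = l j := by
  refine ⟨fun h j => ?_, fun h j _ => (h j).symm⟩
  rcases (a.partner_ne j).lt_or_gt with hj | hj
  · have hmem : a.partner j ∈ a.leftEndpoints := by
      rwa [leftEndpoints, Set.mem_ofPred, a.partner_partner]
    simpa only [a.partner_partner] using h _ hmem
  · exact (h j hj).symm

theorem partner_mem_Ioo (a : CrossinglessMatching n) {j k : Fin (2 * n)}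
    (hk : k ∈ Set.Ioo j (a.partner j)) : a.partner k ∈ Set.Ioo j (a.partner j) := by
  have hinj : Function.Injective a.partner :=
    Function.Involutive.injective a.partner_partner
  constructor
  · by_contra! hle
    have hne : a.partner k ≠ j := fun h => hk.2.ne (by rw [← h, a.partner_partner])
    exact a.crossingless _ _ _ _ (hle.lt_of_ne hne) hk.1 hk.2 ⟨a.partner_partner k, rfl⟩
  · by_contra! hle
    have hne : a.partner j ≠ a.partner k := fun h => hk.1.ne (hinj h)
    exact a.crossingless _ _ _ _ hk.1 hk.2 (hle.lt_of_ne hne) ⟨rfl, rfl⟩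

/- A cup of minimal length encloses no point: the point just after its left end would lie on a
shorter cup. -/
theorem exists_partner_castSucc_eq_succ (a : CrossinglessMatching (n + 1)) :
    ∃ i : Fin (2 * n + 1), a.partner i.castSucc = i.succ := by
  have hne : a.leftEndpoints.Nonempty :=
    ⟨0, lt_of_le_of_ne (Fin.zero_le _) (a.partner_ne 0).symm⟩
  obtain ⟨j, hj, hmin⟩ := Set.exists_min_image a.leftEndpoints
    (fun j => (a.partner j : ℕ) - j) (Set.toFinite _) hne
  obtain ⟨i, rfl⟩ := Fin.exists_castSucc_eq.2 (Fin.ne_last_of_lt hj)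
  refine ⟨i, by_contra fun hcup => ?_⟩
  have hi : i.succ ∈ Set.Ioo i.castSucc (a.partner i.castSucc) :=
    ⟨Fin.castSucc_lt_succ, lt_of_le_of_ne (Fin.castSucc_lt_iff_succ_le.1 hj) (Ne.symm hcup)⟩
  have hi' := a.partner_mem_Ioo hi
  simp only [Set.mem_Ioo, Fin.lt_def] at hi hi'
  rcases (a.partner_ne i.succ).lt_or_gt with h | h
  · have := hmin (a.partner i.succ) (by rwa [leftEndpoints, Set.mem_ofPred, a.partner_partner])
    rw [a.partner_partner] at this
    lia
  · have := hmin i.succ h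
    lia

/-- The crossingless matching obtained by inserting a cup that joins the adjacent points `i` and
`i + 1`. -/
def insertCup (a : CrossinglessMatching n) (i : Fin (2 * n + 1)) :
    CrossinglessMatching (n + 1) where
  partner := insertPartner a.partner i
  partner_partner j := by
    rcases eq_castSucc_or_eq_succ_or_eq_skip i j with rfl | rfl | ⟨k, rfl⟩
    · rw [insertPartner_castSucc, insertPartner_succ]
    · rw [insertPartner_succ, insertPartner_castSucc]
    · rw [insertPartner_skip, insertPartner_skip, a.partner_partner]
  partner_ne j := by
    rcases eq_castSucc_or_eq_succ_or_eq_skip i j with rfl | rfl | ⟨k, rfl⟩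
    · exact insertPartner_castSucc a.partner i ▸ Fin.castSucc_lt_succ.ne'
    · exact insertPartner_succ a.partner i ▸ Fin.castSucc_lt_succ.ne
    · exact insertPartner_skip a.partner i k ▸ (skip_strictMono i).injective.ne (a.partner_ne k)
  crossingless := by
    rintro j₁ j₂ j₃ j₄ h₁₂ h₂₃ h₃₄ ⟨rfl, rfl⟩
    rcases eq_castSucc_or_eq_succ_or_eq_skip i j₁ with rfl | rfl | ⟨k₁, rfl⟩
    · rw [insertPartner_castSucc] at h₂₃
      exact (Fin.castSucc_lt_iff_succ_le.1 h₁₂).not_gt h₂₃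
    · rw [insertPartner_succ] at h₂₃
      exact (h₁₂.trans h₂₃).not_gt Fin.castSucc_lt_succ
    rcases eq_castSucc_or_eq_succ_or_eq_skip i j₂ with rfl | rfl | ⟨k₂, rfl⟩
    · rw [insertPartner_castSucc] at h₃₄
      exact (Fin.castSucc_lt_iff_succ_le.1 h₂₃).not_gt h₃₄
    · rw [insertPartner_succ] at h₃₄
      exact (h₂₃.trans h₃₄).not_gt Fin.castSucc_lt_succ
    simp only [insertPartner_skip, (skip_strictMono i).lt_iff_lt] at h₁₂ h₂₃ h₃₄
    exact a.crossingless _ _ _ _ h₁₂ h₂₃ h₃₄ ⟨rfl, rfl⟩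

theorem exists_eq_insertCup (a : CrossinglessMatching (n + 1)) :
    ∃ (a' : CrossinglessMatching n) (i : Fin (2 * n + 1)), a = a'.insertCup i := by
  obtain ⟨i, hi⟩ := a.exists_partner_castSucc_eq_succ
  have hi' : a.partner i.succ = i.castSucc := hi ▸ a.partner_partner _
  have hskip (k : Fin (2 * n)) : ∃ k', a.partner (skip i k) = skip i k' := by
    rcases eq_castSucc_or_eq_succ_or_eq_skip i (a.partner (skip i k)) with h | h | h
    · exact absurd (by rw [← hi, ← h, a.partner_partner]) (skip_ne_succ i k)
    · exact absurd (by rw [← hi', ← h, a.partner_partner]) (skip_ne_castSucc i k)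
    · exact h
  choose p hp using hskip
  have hinj := (skip_strictMono i).injective
  refine ⟨⟨p, fun k => hinj ?_, fun k hk => ?_, ?_⟩, i,
    CrossinglessMatching.ext (funext fun j => ?_)⟩
  · rw [← hp, ← hp, a.partner_partner]
  · exact a.partner_ne (skip i k) (by rw [hp, hk])
  · rintro k₁ k₂ _ _ h₁₂ h₂₃ h₃₄ ⟨rfl, rfl⟩
    exact a.crossingless _ _ _ _ (skip_strictMono i h₁₂) (skip_strictMono i h₂₃)
      (skip_strictMono i h₃₄) ⟨hp _, hp _⟩
  · rcases eq_castSucc_or_eq_succ_or_eq_skip i j with rfl | rfl | ⟨k, rfl⟩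
    · exact hi.trans (insertPartner_castSucc p i).symm
    · exact hi'.trans (insertPartner_succ p i).symm
    · exact (hp k).trans (insertPartner_skip p i k).symm

theorem mem_subspace_insertCup {a : CrossinglessMatching n} {i : Fin (2 * n + 1)}
    {l : Fin (2 * n + 2) → ComplexProjectiveLine} :
    l ∈ (a.insertCup i).subspace ↔ l i.castSucc = l i.succ ∧ l ∘ skip i ∈ a.subspace := by
  have hmem : l ∈ (a.insertCup i).subspace ↔ ∀ j, l (insertPartner a.partner i j) = l j :=
    mem_subspace_iff
  rw [hmem, mem_subspace_iff]
  refine ⟨fun h => ⟨?_, fun k => ?_⟩, fun ⟨hi, h⟩ j => ?_⟩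
  · rw [← h i.succ, insertPartner_succ]
  · rw [Function.comp_apply, ← insertPartner_skip, h, Function.comp_apply]
  · rcases eq_castSucc_or_eq_succ_or_eq_skip i j with rfl | rfl | ⟨k, rfl⟩
    · rw [insertPartner_castSucc, hi]
    · rw [insertPartner_succ, hi]
    · rw [insertPartner_skip]
      exact h k

instance : Unique (CrossinglessMatching 0) where
  default := ⟨Fin.elim0, fun i => i.elim0, fun i => i.elim0, fun i => i.elim0⟩
  uniq _ := CrossinglessMatching.ext (funext fun i => i.elim0)

instance : Finite (CrossinglessMatching n) :=
  .of_injective partner fun _ _ => CrossinglessMatching.ext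

end CrossinglessMatching

open CrossinglessMatching

theorem khovanovSpace_zero : khovanovSpace 0 = Set.univ :=
  Set.eq_univ_of_forall fun _ => Set.mem_iUnion.2 ⟨default, fun j => j.elim0⟩

theorem mem_khovanovSpace_succ {n : ℕ} {l : Fin (2 * n + 2) → ComplexProjectiveLine} :
    l ∈ khovanovSpace (n + 1) ↔
      ∃ i : Fin (2 * n + 1), l i.castSucc = l i.succ ∧ l ∘ skip i ∈ khovanovSpace n := by
  simp only [khovanovSpace, Set.mem_iUnion]
  constructor
  · rintro ⟨a, ha⟩
    obtain ⟨a, i, rfl⟩ := a.exists_eq_insertCup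
    obtain ⟨hi, h⟩ := mem_subspace_insertCup.1 ha
    exact ⟨i, hi, a, h⟩
  · rintro ⟨i, hi, a, h⟩
    exact ⟨a.insertCup i, mem_subspace_insertCup.2 ⟨hi, h⟩⟩

theorem isCompact_khovanovSpace (n : ℕ) : IsCompact (khovanovSpace n) := by
  refine (isClosed_iUnion_of_finite fun a => ?_).isCompact
  simp only [CrossinglessMatching.subspace, Set.ofPred_forall]
  exact isClosed_biInter fun j _ => isClosed_eq (continuous_apply _) (continuous_apply _)

theorem alternate_mem_convolutionFiber_iff {n : ℕ} {l : Fin (2 * n) → ComplexProjectiveLine} :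
    alternate l ∈ convolutionFiber ℂ (Fin 2) (2 * n) n ↔ l ∈ khovanovSpace n := by
  induction n with
  | zero =>
    rw [khovanovSpace_zero]
    refine iff_of_true ?_ trivial
    change lattice (alternate l) 0 = _
    rw [lattice_zero, pow_zero, Module.End.one_eq_id, LinearMap.range_id]
  | succ n ih =>
    rw [mem_khovanovSpace_succ]
    refine mem_convolutionFiber_succ.trans (exists_congr fun i : Fin (2 * n + 1) => ?_)
    rw [← alternate_comp_skip l i]
    exact and_congr (alternate_succ_eq_perp_iff l i) ih

section StarProjection

variable {𝕜 F : Type*} [RCLike 𝕜] [NormedAddCommGroup F] [InnerProductSpace 𝕜 F]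

theorem starProjection_sup_of_isOrtho {U V : Submodule 𝕜 F} [U.HasOrthogonalProjection]
    [V.HasOrthogonalProjection] [(U ⊔ V).HasOrthogonalProjection] (h : U ⟂ V) (x : F) :
    (U ⊔ V).starProjection x = U.starProjection x + V.starProjection x := by
  refine Submodule.eq_starProjection_of_mem_orthogonal
    (Submodule.add_mem_sup (U.starProjection_apply_mem x) (V.starProjection_apply_mem x)) ?_
  rw [← Submodule.inf_orthogonal]
  constructor
  · rw [← sub_sub]
    exact sub_mem (U.sub_starProjection_mem_orthogonal x) (h.symm (V.starProjection_apply_mem x))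
  · rw [sub_add_eq_sub_sub_swap]
    exact sub_mem (V.sub_starProjection_mem_orthogonal x) (h (U.starProjection_apply_mem x))

theorem sup_span_sub_starProjection (K : Submodule 𝕜 F) [K.HasOrthogonalProjection] (v : F) :
    K ⊔ 𝕜 ∙ (v - K.starProjection v) = 𝕜 ∙ v ⊔ K := by
  have hPv : K.starProjection v ∈ K := K.starProjection_apply_mem v
  refine le_antisymm (sup_le le_sup_right ?_) (sup_le ?_ le_sup_left)
  · exact (Submodule.span_singleton_le_iff_mem _ _).2 <| sub_mem
      (Submodule.mem_sup_left (Submodule.mem_span_singleton_self v)) (Submodule.mem_sup_right hPv)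
  · refine (Submodule.span_singleton_le_iff_mem _ _).2 ?_
    have := Submodule.add_mem_sup hPv (Submodule.mem_span_singleton_self (R := 𝕜)
      (v - K.starProjection v))
    rwa [add_sub_cancel] at this

variable {X : Type*} [TopologicalSpace X]

theorem continuous_starProjection_span_singleton {r y : X → F} (hr : Continuous r)
    (hr0 : ∀ x, r x ≠ 0) (hy : Continuous y) :
    Continuous fun x => (𝕜 ∙ r x).starProjection (y x) := by
  simp only [Submodule.starProjection_singleton]
  refine ((hr.inner hy).div (RCLike.continuous_ofReal.comp (hr.norm.pow 2)) fun x => ?_).smul hr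
  simpa using hr0 x

theorem continuous_starProjection_flag [FiniteDimensional 𝕜 F] {m : ℕ} {b : X → Basis (Fin m) 𝕜 F}
    (hb : ∀ i, Continuous fun x => b x i) (j : Fin (m + 1)) {y : X → F} (hy : Continuous y) :
    Continuous fun x => ((b x).flag j).starProjection (y x) := by
  induction j using Fin.induction generalizing y with
  | zero => simpa using continuous_const
  | succ j ih =>
    let K (x : X) : Submodule 𝕜 F := (b x).flag j.castSucc
    let r (x : X) : F := b x j - (K x).starProjection (b x j)
    have hr : Continuous r := (hb j).sub (ih (hb j))
    have hr0 (x : X) : r x ≠ 0 := fun h => by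
      have : b x j ∈ K x := Submodule.starProjection_eq_self_iff.1 (sub_eq_zero.1 h).symm
      simp [K] at this
    have hortho (x : X) : K x ⟂ 𝕜 ∙ r x :=
      Submodule.isOrtho_iff_le.1 <| Submodule.IsOrtho.symm <|
        (Submodule.span_singleton_le_iff_mem _ _).2 ((K x).sub_starProjection_mem_orthogonal _)
    have hflag (x : X) : (b x).flag j.succ = K x ⊔ 𝕜 ∙ r x := by
      rw [Basis.flag_succ, sup_span_sub_starProjection]
    simp only [hflag, starProjection_sup_of_isOrtho (hortho _)]
    exact (ih hy).add (continuous_starProjection_span_singleton hr hr0 hy)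

end StarProjection

namespace CompleteFlag

variable {m : ℕ} {E : Type*} [AddCommGroup E] [Module ℂ E]

theorem continuous_ofBasis_comp [TopologicalSpace E] {X : Type*} [TopologicalSpace X]
    {b : X → Basis (Fin m) ℂ E} (hb : ∀ i, Continuous fun x => b x i) :
    Continuous fun x => ofBasis (b x) := by
  let _ : TopologicalSpace (Basis (Fin m) ℂ E) := .induced (fun b i => b i) inferInstance
  exact (continuous_coinduced_rng (f := ofBasis)).comp
    (continuous_induced_rng.2 (continuous_pi hb))

theorem continuous_starProjection_map_space [TopologicalSpace E] {F : Type*}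
    [NormedAddCommGroup F] [InnerProductSpace ℂ F] [FiniteDimensional ℂ F] {φ : E ≃ₗ[ℂ] F}
    (hφ : Continuous φ) (j : Fin (m + 1)) (y : F) :
    Continuous fun L : CompleteFlag m E => ((L.space j).map φ.toLinearMap).starProjection y := by
  let _ : TopologicalSpace (Basis (Fin m) ℂ E) := .induced (fun b i => b i) inferInstance
  refine continuous_coinduced_dom.2 ?_
  have hcoe : Continuous fun (b : Basis (Fin m) ℂ E) i => b i := continuous_induced_dom
  have hb (i : Fin m) : Continuous fun b : Basis (Fin m) ℂ E => b.map φ i :=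
    hφ.comp (continuous_pi_iff.1 hcoe i)
  have hflag (b : Basis (Fin m) ℂ E) : (b.map φ).flag j = (b.flag j).map φ.toLinearMap := by
    rw [Basis.flag, Basis.flag, Submodule.map_span, Set.image_image]
    rfl
  have hproj := continuous_starProjection_flag hb j (continuous_const (y := y))
  simp only [hflag] at hproj
  exact hproj

instance [TopologicalSpace E] [IsTopologicalAddGroup E] [ContinuousSMul ℂ E] [T2Space E]
    [FiniteDimensional ℂ E] : T2Space (CompleteFlag m E) := by
  let φ : E ≃ₗ[ℂ] EuclideanSpace ℂ (Fin (finrank ℂ E)) := .ofFinrankEq _ _ (by simp)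
  have hφ : Continuous φ := LinearMap.continuous_of_finiteDimensional φ.toLinearMap
  refine .of_injective_continuous
    (f := fun (L : CompleteFlag m E) (p : Fin (m + 1) × _) =>
      ((L.space p.1).map φ.toLinearMap).starProjection p.2) (fun L L' h => ?_)
    (continuous_pi fun p => continuous_starProjection_map_space hφ p.1 p.2)
  refine CompleteFlag.ext (funext fun j => ?_)
  refine Submodule.map_injective_of_injective φ.injective (Submodule.ext fun y => ?_)
  rw [← Submodule.starProjection_eq_self_iff, ← Submodule.starProjection_eq_self_iff]
  exact Eq.congr_left (congrFun h (j, y))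

variable [FiniteDimensional ℂ E]

theorem finrank_space (L : CompleteFlag m E) (hm : finrank ℂ E = m) (j : Fin (m + 1)) :
    finrank ℂ (L.space j) = j := by
  have hlt (j : Fin (m + 1)) : finrank ℂ (L.space j) < m + 1 :=
    Nat.lt_succ_of_le ((Submodule.finrank_le _).trans_eq hm)
  have hmono : StrictMono fun j => (⟨finrank ℂ (L.space j), hlt j⟩ : Fin (m + 1)) :=
    fun _ _ hij => Submodule.finrank_lt_finrank_of_lt (L.strictMono hij)
  exact le_antisymm hmono.apply_le hmono.le_apply

theorem space_covBy (L : CompleteFlag m E) (hm : finrank ℂ E = m) (i : Fin m) :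
    L.space i.castSucc ⋖ L.space i.succ := by
  refine ⟨L.strictMono Fin.castSucc_lt_succ, fun K hK hK' => ?_⟩
  have hK := Submodule.finrank_lt_finrank_of_lt hK
  have hK' := Submodule.finrank_lt_finrank_of_lt hK'
  rw [L.finrank_space hm] at hK hK'
  simp only [Fin.val_castSucc, Fin.val_succ] at hK hK'
  lia

theorem exists_ofBasis_eq (L : CompleteFlag m E) (hm : finrank ℂ E = m) {v : Fin m → E}
    (hv : ∀ i, v i ∈ L.space i.succ) (hv' : ∀ i, v i ∉ L.space i.castSucc) :
    ∃ b : Basis (Fin m) ℂ E, ⇑b = v ∧ ofBasis b = L := by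
  have hspace (i : Fin m) : L.space i.succ ≤ ℂ ∙ v i ⊔ L.space i.castSucc := by
    have hle : ℂ ∙ v i ⊔ L.space i.castSucc ≤ L.space i.succ :=
      sup_le ((Submodule.span_singleton_le_iff_mem _ _).2 (hv i)) (L.space_covBy hm i).le
    refine (((L.space_covBy hm i).eq_or_eq le_sup_right hle).resolve_left fun h => hv' i ?_).ge
    exact h.le (Submodule.mem_sup_left (Submodule.mem_span_singleton_self _))
  have hspan (j : Fin (m + 1)) {p : Submodule ℂ E} (hp : ∀ i : Fin m, i.castSucc < j → v i ∈ p) :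
      L.space j ≤ p := by
    induction j using Fin.induction with
    | zero => exact L.space_zero ▸ bot_le
    | succ i ih =>
      refine (hspace i).trans (sup_le ?_ (ih fun k hk => hp k (hk.trans Fin.castSucc_lt_succ)))
      exact (Submodule.span_singleton_le_iff_mem _ _).2 (hp i Fin.castSucc_lt_succ)
  have htop : ⊤ ≤ Submodule.span ℂ (Set.range v) := by
    rw [← L.space_last]
    exact hspan _ fun i _ => Submodule.subset_span ⟨i, rfl⟩
  let b := basisOfTopLeSpanOfCardEqFinrank v htop (by simp [hm])
  have hb : ⇑b = v := coe_basisOfTopLeSpanOfCardEqFinrank v htop (by simp [hm])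
  refine ⟨b, hb, CompleteFlag.ext (funext fun j => le_antisymm ?_ ?_)⟩
  · refine b.flag_le_iff.2 fun i hi => ?_
    rw [hb]
    exact L.strictMono.monotone (Fin.castSucc_lt_iff_succ_le.1 hi) (hv i)
  · exact hspan j fun i hi => hb ▸ b.self_mem_flag hi

theorem continuous_of_adapted [TopologicalSpace E] {X : Type*} [TopologicalSpace X]
    {f : X → CompleteFlag m E} (hm : finrank ℂ E = m) {v : X → Fin m → E} (hv : Continuous v)
    (hmem : ∀ x i, v x i ∈ (f x).space i.succ) (hnotMem : ∀ x i, v x i ∉ (f x).space i.castSucc) :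
    Continuous f := by
  choose b hb hbf using fun x => (f x).exists_ofBasis_eq hm (hmem x) (hnotMem x)
  have hbv (i : Fin m) : Continuous fun x => b x i := by
    simp only [hb]
    fun_prop
  exact (funext hbf : (fun x => ofBasis (b x)) = f) ▸ continuous_ofBasis_comp hbv

end CompleteFlag

section Truncation

variable {R ι E : Type*} [Ring R] [AddCommGroup E] [Module R E] {n : ℕ}

/-- The basis `b`, made of blocks of size `n` indexed by `ι`, is a Jordan basis for the nilpotent
endomorphism `z`, which sends the first vector of each block to `0` and every other one to its
predecessor. -/
def IsNilpotentJordanBasis (b : Basis (ι × Fin n) R E) (z : E →ₗ[R] E) : Prop :=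
  ∀ (i : ι) (k : Fin n), ((k : ℕ) = 0 → z (b (i, k)) = 0) ∧
    ∀ k' : Fin n, (k : ℕ) = (k' : ℕ) + 1 → z (b (i, k)) = b (i, k')

variable [Fintype ι]

/-- The truncation of series in `R⟦t⟧ ^ ι` modulo `t ^ n`, read in a basis made of blocks of
size `n`: the coefficient of `t ^ k` goes to position `n - 1 - k`, so that multiplication by `t`
moves each basis vector to its predecessor. -/
noncomputable def trunc (b : Basis (ι × Fin n) R E) : (ℕ → ι → R) →ₗ[R] E :=
  b.equivFun.symm.toLinearMap ∘ₗ
    LinearMap.pi fun p => LinearMap.proj p.1 ∘ₗ LinearMap.proj (p.2.rev : ℕ)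

variable (b : Basis (ι × Fin n) R E)

theorem trunc_apply (x : ℕ → ι → R) : trunc b x = b.equivFun.symm fun p => x p.2.rev p.1 := rfl

theorem trunc_eq_sum (x : ℕ → ι → R) :
    trunc b x = ∑ i, ∑ k : Fin n, x k.rev i • b (i, k) := by
  rw [trunc_apply, Basis.equivFun_symm_apply, Fintype.sum_prod_type]

theorem ker_trunc : LinearMap.ker (trunc b) = LinearMap.range (shift ^ n) := by
  ext x
  rw [LinearMap.mem_ker, trunc_apply, LinearEquiv.map_eq_zero_iff, mem_range_shift_pow]
  constructor
  · intro h k hk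
    ext i
    simpa using congrFun h (i, Fin.rev ⟨k, hk⟩)
  · intro h
    ext p
    rw [h _ p.2.rev.2]
    rfl

theorem trunc_surjective : Function.Surjective (trunc b) := by
  intro v
  refine ⟨fun k i => if h : k < n then b.equivFun v (i, Fin.rev ⟨k, h⟩) else 0, ?_⟩
  rw [trunc_apply, LinearEquiv.symm_apply_eq]
  ext p
  rw [dif_pos p.2.rev.2, Fin.eta, Fin.rev_rev]

variable {b} in
theorem IsNilpotentJordanBasis.trunc_shift {z : E →ₗ[R] E} (hb : IsNilpotentJordanBasis b z)
    (x : ℕ → ι → R) : trunc b (shift (R := R) x) = z (trunc b x) := by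
  rw [trunc_eq_sum, trunc_eq_sum, map_sum]
  refine Finset.sum_congr rfl fun i _ => ?_
  cases n with
  | zero => simp
  | succ n =>
    rw [Fin.sum_univ_castSucc, Fin.sum_univ_succ, map_add, map_sum, map_smul, (hb i 0).1 rfl,
      smul_zero, zero_add]
    simp only [Fin.rev_last, Fin.val_zero, shift_apply_zero, Pi.zero_apply, zero_smul, add_zero,
      Fin.rev_castSucc, Fin.rev_succ, Fin.val_succ, Fin.val_castSucc, shift_apply_succ, map_smul]
    exact Finset.sum_congr rfl fun k _ => by rw [(hb i k.succ).2 k.castSucc rfl]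

theorem continuous_trunc [TopologicalSpace R] [TopologicalSpace E] [ContinuousAdd E]
    [ContinuousSMul R E] : Continuous (trunc b) := by
  simp only [funext (trunc_eq_sum b)]
  fun_prop

end Truncation

section FlagOfLines

variable {ι E : Type*} [Fintype ι] [AddCommGroup E] [Module ℂ E] {m n : ℕ}
  (b : Basis (ι × Fin n) ℂ E)

theorem comap_map_trunc_lattice (l : convolutionFiber ℂ ι m n) (j : Fin (m + 1)) :
    ((lattice l.1 j).map (trunc b)).comap (trunc b) = lattice l.1 j := by
  refine Submodule.comap_map_eq_self ?_
  rw [ker_trunc, ← l.2]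
  exact (lattice_strictAnti l.1).antitone (Fin.le_last j)

/-- The complete flag of the truncated lattices of a sequence of lines. The lattices descend, which
reverses their order in the flag. -/
noncomputable def flagOfLines (l : convolutionFiber ℂ ι m n) : CompleteFlag m E where
  space j := (lattice l.1 j.rev).map (trunc b)
  strictMono i j hij := by
    rw [← Submodule.comap_lt_comap_iff_of_surjective (trunc_surjective b),
      comap_map_trunc_lattice, comap_map_trunc_lattice]
    exact lattice_strictAnti l.1 (Fin.rev_lt_rev.2 hij)
  space_zero := by
    rw [Fin.rev_zero, l.2, ← ker_trunc b]
    exact LinearMap.le_ker_iff_map.1 le_rfl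
  space_last := by
    rw [Fin.rev_last, lattice_zero, Submodule.map_top,
      LinearMap.range_eq_top.2 (trunc_surjective b)]

theorem comap_trunc_flagOfLines_space (l : convolutionFiber ℂ ι m n) (j : Fin (m + 1)) :
    ((flagOfLines b l).space j).comap (trunc b) = lattice l.1 j.rev :=
  comap_map_trunc_lattice b l j.rev

theorem flagOfLines_injective :
    Function.Injective (flagOfLines b : convolutionFiber ℂ ι m n → CompleteFlag m E) := by
  intro l l' h
  refine Subtype.ext (lattice_injective (funext fun j => ?_))
  rw [← Fin.rev_rev j, ← comap_trunc_flagOfLines_space b, h, comap_trunc_flagOfLines_space]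

variable {b}

theorem map_flagOfLines_space_le {z : E →ₗ[ℂ] E} (hb : IsNilpotentJordanBasis b z)
    (l : convolutionFiber ℂ ι m n) (j : Fin (m + 1)) :
    ((flagOfLines b l).space j).map z ≤ (flagOfLines b l).space j := by
  rintro _ ⟨_, ⟨x, hx, rfl⟩, rfl⟩
  exact ⟨shift x, lattice_le_comap_shift l.1 _ hx, hb.trunc_shift x⟩

theorem exists_flagOfLines_eq {z : E →ₗ[ℂ] E} (hb : IsNilpotentJordanBasis b z)
    (hm : finrank ℂ E = m) {L : CompleteFlag m E} (hL : ∀ j, (L.space j).map z ≤ L.space j) :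
    ∃ l : convolutionFiber ℂ ι m n, flagOfLines b l = L := by
  have : FiniteDimensional ℂ E := b.finiteDimensional_of_finite
  let N (j : Fin (m + 1)) : Submodule ℂ (ℕ → ι → ℂ) := (L.space j.rev).comap (trunc b)
  have hcov (i : Fin m) : N i.succ ⋖ N i.castSucc := by
    have h := L.space_covBy hm i.rev
    rw [← Fin.rev_succ, ← Fin.rev_castSucc] at h
    exact comap_covBy_comap h (LinearMap.range_eq_top.2 (trunc_surjective b) ▸ le_top)
  have hshift (j : Fin (m + 1)) : N j ≤ (N j).comap shift := fun x hx => by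
    rw [Submodule.mem_comap, Submodule.mem_comap, hb.trunc_shift]
    exact hL _ (Submodule.mem_map_of_mem hx)
  have hker (j : Fin (m + 1)) : LinearMap.range (shift ^ n) ≤ N j :=
    ker_trunc b ▸ LinearMap.ker_le_comap (trunc b)
  obtain ⟨l, hl⟩ := exists_eq_lattice (by simp [N, L.space_last]) hcov hshift hker
  have hlast : lattice l (Fin.last m) = LinearMap.range (shift ^ n) := by
    rw [← hl, ← ker_trunc b]
    simp only [N, Fin.rev_last, L.space_zero, Submodule.comap_bot]
  refine ⟨⟨l, hlast⟩, CompleteFlag.ext (funext fun j => ?_)⟩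
  refine Submodule.comap_injective_of_surjective (trunc_surjective b) ?_
  rw [comap_trunc_flagOfLines_space, ← hl]
  simp only [N, Fin.rev_rev]

theorem range_flagOfLines {z : E →ₗ[ℂ] E} (hb : IsNilpotentJordanBasis b z)
    (hm : finrank ℂ E = m) :
    Set.range (flagOfLines b : convolutionFiber ℂ ι m n → CompleteFlag m E) =
      {L | ∀ j, (L.space j).map z ≤ L.space j} :=
  Set.Subset.antisymm (Set.range_subset_iff.2 (map_flagOfLines_space_le hb))
    fun _ hL => exists_flagOfLines_eq hb hm hL

theorem continuous_flagOfLines [TopologicalSpace E] [ContinuousAdd E] [ContinuousSMul ℂ E]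
    (hm : finrank ℂ E = m) :
    Continuous (flagOfLines b : convolutionFiber ℂ ι m n → CompleteFlag m E) := by
  have : FiniteDimensional ℂ E := b.finiteDimensional_of_finite
  let p : (Fin m → {v : ι → ℂ // v ≠ 0}) → Fin m → ℙ ℂ (ι → ℂ) :=
    Pi.map fun _ => Projectivization.mk' ℂ
  have hp : IsOpenQuotientMap p :=
    .piMap fun _ => isOpenQuotientMap_projectivization_mk'
  refine (hp.restrictPreimage _).continuous_comp_iff.1 ?_
  -- The factors before the `i`-th one, applied to a vector of the `i`-th line, give a vector
  -- of the `i`-th lattice that is not in the next one.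
  let S := p ⁻¹' convolutionFiber ℂ ι m n
  let x (u : S) (i : Fin m) : ℕ → ι → ℂ :=
    factorProd (p u) i.castSucc fun _ => u.1 i
  have hx : Continuous x := by
    refine continuous_pi fun i => continuous_factorProd_apply
      (hp.continuous.comp continuous_subtype_val) (continuous_pi fun _ => ?_) _
    exact continuous_subtype_val.comp ((continuous_apply i).comp continuous_subtype_val)
  have hmem (u : S) (i : Fin m) : x u i ∈ lattice (p u) i.castSucc := ⟨_, rfl⟩
  have hnotMem (u : S) (i : Fin m) : x u i ∉ lattice (p u) i.succ := fun h => by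
    rw [factorProd_mem_lattice_succ] at h
    exact (u.1 i).2 ((lineProj_mk_mulVec_self _ (u.1 i).2).symm.trans h)
  refine CompleteFlag.continuous_of_adapted hm (v := fun u i => trunc b (x u i.rev))
    (continuous_pi fun i => (continuous_trunc b).comp (continuous_pi_iff.1 hx _))
    (fun u i => ?_) fun u i => ?_
  · rw [← Submodule.mem_comap, Function.comp_apply, comap_trunc_flagOfLines_space, Fin.rev_succ]
    exact hmem u i.rev
  · rw [← Submodule.mem_comap, Function.comp_apply, comap_trunc_flagOfLines_space,
      Fin.rev_castSucc]
    exact hnotMem u i.rev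

end FlagOfLines

theorem theorem1 {E : Type*} [AddCommGroup E] [Module ℂ E] [TopologicalSpace E]
    [IsTopologicalAddGroup E] [ContinuousSMul ℂ E] [T2Space E]
    (n : ℕ) (z : E →ₗ[ℂ] E) (hz : HasTwoNilpotentJordanBlocks n z) :
    Nonempty (springerVariety n z ≃ₜ khovanovSpace n) := by
  obtain ⟨b, hb⟩ := hz
  have hdim : finrank ℂ E = 2 * n := by simp [finrank_eq_card_basis b]
  have : FiniteDimensional ℂ E := b.finiteDimensional_of_finite
  let alternation : (Fin (2 * n) → ComplexProjectiveLine) ≃ₜ _ :=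
    { toEquiv := alternate_involutive.toPerm
      continuous_toFun := continuous_alternate
      continuous_invFun := continuous_alternate }
  let e : khovanovSpace n ≃ₜ convolutionFiber ℂ (Fin 2) (2 * n) n :=
    alternation.subtype fun _ => alternate_mem_convolutionFiber_iff.symm
  have : CompactSpace (khovanovSpace n) := isCompact_iff_compactSpace.1 (isCompact_khovanovSpace n)
  have : CompactSpace (convolutionFiber ℂ (Fin 2) (2 * n) n) := e.compactSpace
  let φ : convolutionFiber ℂ (Fin 2) (2 * n) n → CompleteFlag (2 * n) E := flagOfLines b
  have hφ : Topology.IsClosedEmbedding φ :=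
    (continuous_flagOfLines hdim).isClosedEmbedding (flagOfLines_injective b)
  have hrange : Set.range φ = springerVariety n z := range_flagOfLines hb hdim
  exact ⟨(e.trans (hφ.isEmbedding.toHomeomorph.trans (.setCongr hrange))).symm⟩
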